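/- Let $G$ be a finite connected simple graph. A \emph{random walk labeling} of $G$ is a labeling $\ell : V(G)\to\mathbb{N}$ of all its vertices that is obtainable by the following process: set $i=1$, choose a vertex $v$ and label it with $1$; then, as long as there are unlabeled vertices, choose a vertex $w$ adjacent to $v$, replace $v$ with $w$, and, if the new $v$ is not labeled yet, increase $i$ by $1$ and label $v$ with $i$. Let $\mathcal{L}(G)$ denote the number of random walk labelings of $G$ (two labelings are the same if they are equal as functions on the vertex set). Theorem. For $n\ge 2$ let $C_2\times C_n$ be the Cartesian product of the cycle graphs $C_2$ and $C_n$, where $C_2$ is understood as the graph consisting of a single edge. Then for every integer $n\ge 2$ $$\mathcal{L}(C_2\times C_n)=\frac{n(n+2)(2n-2)!}{(n-2)!}.$$ -/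

import Mathlib

/-- The states of the labeling process of a random walk on `G`. `RandomWalkProcess G v i lab` says
that the process can reach the state in which the walk stands at `v`, the current value of the
counter is `i`, and the partial labeling is `lab`, where `lab x = none` means that the vertex `x`
is not labeled yet and `lab x = some j` means that it carries the label `j`. -/
inductive RandomWalkProcess {V : Type*} [DecidableEq V] (G : SimpleGraph V) :
    V → ℕ → (V → Option ℕ) → Prop
  /-- Set `i = 1`, choose a vertex `v`, and label it with `1`. -/
  | start (v : V) :
      RandomWalkProcess G v 1 (Function.update (fun _ => none) v (some 1))
  /-- As long as some vertex `u` is unlabeled, the walk may move to a neighbor `w`; if `w` is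
  already labeled, neither the counter nor the labeling changes. -/
  | revisit (v w u : V) (i : ℕ) (lab : V → Option ℕ) :
      RandomWalkProcess G v i lab → lab u = none → G.Adj v w → lab w ≠ none →
        RandomWalkProcess G w i lab
  /-- If the neighbor `w` is unlabeled, the counter is increased by one and `w` receives the new
  value of the counter as its label. -/
  | visit (v w : V) (i : ℕ) (lab : V → Option ℕ) :
      RandomWalkProcess G v i lab → G.Adj v w → lab w = none →
        RandomWalkProcess G w (i + 1) (Function.update lab w (some (i + 1)))

/-- A labeling of all vertices of `G` is a random walk labeling if the process can reach it. -/
def IsRandomWalkLabeling {V : Type*} [DecidableEq V] (G : SimpleGraph V) (l : V → ℕ) : Prop :=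
  ∃ (v : V) (i : ℕ), RandomWalkProcess G v i (fun x => some (l x))

/-- The number `𝓛(G)` of random walk labelings of `G`. -/
noncomputable def numRandomWalkLabelings {V : Type*} [DecidableEq V] (G : SimpleGraph V) : ℕ :=
  {l : V → ℕ | IsRandomWalkLabeling G l}.ncard

/-! The walk can move freely inside the connected visited set, so a labeling is an ordering of the
vertices in which each new vertex has an earlier neighbor; `numRandomWalkLabelings_eq_sum` counts
these orderings by starting vertex. On the circular ladder, the untouched rungs form one arc, up to
the end phases. An unvisited cell on a touched rung (a hole) is always available, and only holes on
the two rungs bordering the arc affect later choices. So the proportion of admissible orders of the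
unvisited cells depends only on the arc length `m` and the four border cells, not on the number of
holes. This proportion is `arcWeight`; conditioning on the next cell gives the recursions
`arcWeight_succ_succ` and `arcWeight_one`, and `IsArc.numCompletions` follows by induction. With `n
= k + 2`, a second vertex on the starting rung gives weight `1 / k!`, and each of the two along the
cycle gives `(k + 2) / (4 k!)` when `k > 0`. Their sum, times `(2k + 2)!` and the `2n` starting
vertices, is the formula. For `n = 2` the two steps along the cycle coincide, and that case is
counted directly. -/

open Classical in
/-- The vertices outside `S` with a neighbor in `S`. -/
noncomputable def outerBoundary {V : Type*} [Fintype V] (G : SimpleGraph V) (S : Finset V) :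
    Finset V :=
  Finset.univ.filter fun w => w ∉ S ∧ ∃ v ∈ S, G.Adj v w

/-! ### Random walk labelings as connected vertex orders -/

section Completions

variable {V : Type*} [Fintype V] [DecidableEq V] (G : SimpleGraph V)

omit [DecidableEq V] in
theorem mem_outerBoundary {S : Finset V} {w : V} :
    w ∈ outerBoundary G S ↔ w ∉ S ∧ ∃ v ∈ S, G.Adj v w := by
  simp [outerBoundary]

/-- The number of ways to visit `r` further vertices one after the other, starting from the set `S`
of visited vertices, where each new vertex is adjacent to a visited one. -/
noncomputable def numCompletions : ℕ → Finset V → ℕ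
  | 0, _ => 1
  | r + 1, S => ∑ w ∈ outerBoundary G S, numCompletions r (insert w S)

/-- The labelings that arise from the labeling `l` of `S` by visiting `r` further vertices. -/
noncomputable def completions : ℕ → Finset V → (V → ℕ) → Finset (V → ℕ)
  | 0, _, l => {l}
  | r + 1, S, l => (outerBoundary G S).biUnion fun w =>
      completions r (insert w S) (Function.update l w (S.card + 1))

/-- Later labels exceed all counter values used so far, so a labeling determines its order of
visits. This makes the unions in `card_completions` and `numRandomWalkLabelings_eq_sum` disjoint. -/
theorem completions_spec (r : ℕ) (S : Finset V) (l l' : V → ℕ) (hr : S.card + r = Fintype.card V)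
    (h : l' ∈ completions G r S l) :
    (∀ x ∈ S, l' x = l x) ∧ ∀ x ∉ S, S.card < l' x := by
  induction r generalizing S l with
  | zero =>
    have hS : S = Finset.univ := by
      rw [← Finset.card_eq_iff_eq_univ]; omega
    simp only [completions, Finset.mem_singleton] at h
    subst h hS
    simp
  | succ r ih =>
    simp only [completions, Finset.mem_biUnion] at h
    obtain ⟨w, hw, hl⟩ := h
    have hwS := ((mem_outerBoundary G).1 hw).1
    have hc := Finset.card_insert_of_notMem hwS
    obtain ⟨h1, h2⟩ := ih _ _ (by omega) hl
    refine ⟨fun x hx => ?_, fun x hx => ?_⟩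
    · rw [h1 x (Finset.mem_insert_of_mem hx), Function.update_of_ne]
      rintro rfl; exact hwS hx
    · by_cases hxw : x = w
      · subst hxw
        rw [h1 x (Finset.mem_insert_self _ _), Function.update_self]; omega
      · have := h2 x (by simp [hxw, hx])
        omega

theorem card_completions (r : ℕ) (S : Finset V) (l : V → ℕ) (hr : S.card + r = Fintype.card V) :
    (completions G r S l).card = numCompletions G r S := by
  induction r generalizing S l with
  | zero => simp [completions, numCompletions]
  | succ r ih =>
    have hc : ∀ w ∈ outerBoundary G S, (insert w S).card + r = Fintype.card V := by
      intro w hw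
      rw [Finset.card_insert_of_notMem ((mem_outerBoundary G).1 hw).1]; omega
    rw [completions, numCompletions, Finset.card_biUnion]
    · exact Finset.sum_congr rfl fun w hw => ih _ _ (hc w hw)
    · intro w hw w' hw' hne
      rw [Function.onFun, Finset.disjoint_left]
      intro l' h h'
      -- The label of `w` would be `S.card + 1` if `w` came next, but larger if `w'` did.
      have h1 := (completions_spec G _ _ _ _ (hc w hw) h).1 w (Finset.mem_insert_self _ _)
      have h2 := (completions_spec G _ _ _ _ (hc w' hw') h').2 w
        (by simp [hne, ((mem_outerBoundary G).1 hw).1])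
      rw [Finset.card_insert_of_notMem ((mem_outerBoundary G).1 hw').1] at h2
      rw [Function.update_self] at h1
      omega

/-- The partial labeling that agrees with `l` on `S` and is undefined elsewhere. -/
def partialLabeling (S : Finset V) (l : V → ℕ) : V → Option ℕ :=
  fun x => if x ∈ S then some (l x) else none

omit [Fintype V] in
theorem partialLabeling_insert (S : Finset V) (l : V → ℕ) (w : V) (j : ℕ) :
    partialLabeling (insert w S) (Function.update l w j) =
      Function.update (partialLabeling S l) w (some j) := by
  funext x
  by_cases hx : x = w
  · subst hx; simp [partialLabeling]
  · simp [partialLabeling, hx]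

/-- Any two elements of `S` are joined by a walk inside `S`. -/
def WalkConnected (S : Finset V) : Prop :=
  ∀ a ∈ S, ∀ b ∈ S, Relation.ReflTransGen (fun x y => G.Adj x y ∧ y ∈ S) a b

omit [Fintype V] in
theorem walkConnected_insert {S : Finset V} (hS : WalkConnected G S) {v w : V} (hv : v ∈ S)
    (hvw : G.Adj v w) : WalkConnected G (insert w S) := by
  have key : ∀ a ∈ S, ∀ b ∈ S,
      Relation.ReflTransGen (fun x y => G.Adj x y ∧ y ∈ insert w S) a b := fun a ha b hb =>
    by
    refine Relation.ReflTransGen.mono (fun x y h => ?_) a b (hS a ha b hb)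
    exact ⟨h.1, Finset.mem_insert_of_mem h.2⟩
  have hw : ∀ a ∈ S, Relation.ReflTransGen (fun x y => G.Adj x y ∧ y ∈ insert w S) a w :=
    fun a ha => (key a ha v hv).tail ⟨hvw, Finset.mem_insert_self _ _⟩
  have hw' : ∀ a ∈ S, Relation.ReflTransGen (fun x y => G.Adj x y ∧ y ∈ insert w S) w a :=
    fun a ha => (key v hv a ha).head ⟨hvw.symm, Finset.mem_insert_of_mem hv⟩
  intro a ha b hb
  rcases Finset.mem_insert.1 ha with rfl | ha' <;> rcases Finset.mem_insert.1 hb with rfl | hb'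
  · exact .refl
  · exact hw' b hb'
  · exact hw a ha'
  · exact key a ha' b hb'

omit [Fintype V] in
theorem RandomWalkProcess.move {S : Finset V} {l : V → ℕ} {i : ℕ} {a b u : V}
    (hp : RandomWalkProcess G a i (partialLabeling S l)) (hu : u ∉ S)
    (hab : Relation.ReflTransGen (fun x y => G.Adj x y ∧ y ∈ S) a b) :
    RandomWalkProcess G b i (partialLabeling S l) := by
  induction hab with
  | refl => exact hp
  | tail _ h ih =>
    exact .revisit _ _ u _ _ ih (by simp [partialLabeling, hu]) h.1 (by simp [partialLabeling, h.2])

theorem isRandomWalkLabeling_of_mem_completions (r : ℕ) (S : Finset V) (l l' : V → ℕ) (a : V)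
    (hr : S.card + r = Fintype.card V) (ha : a ∈ S) (hS : WalkConnected G S)
    (hp : RandomWalkProcess G a S.card (partialLabeling S l)) (h : l' ∈ completions G r S l) :
    IsRandomWalkLabeling G l' := by
  induction r generalizing S l a with
  | zero =>
    have hS : S = Finset.univ := by
      rw [← Finset.card_eq_iff_eq_univ]; omega
    simp only [completions, Finset.mem_singleton] at h
    subst h hS
    have hl : partialLabeling Finset.univ l' = fun x => some (l' x) := by
      funext x; simp [partialLabeling]
    exact ⟨a, _, hl ▸ hp⟩
  | succ r ih =>
    simp only [completions, Finset.mem_biUnion] at h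
    obtain ⟨w, hw, hl⟩ := h
    obtain ⟨hwS, v, hv, hvw⟩ := (mem_outerBoundary G).1 hw
    have hc := Finset.card_insert_of_notMem hwS
    refine ih _ _ w (by omega) (Finset.mem_insert_self _ _) (walkConnected_insert G hS hv hvw) ?_ hl
    rw [partialLabeling_insert, hc]
    -- The unlabeled vertex needed to keep walking inside `S` is the target `w` itself.
    exact .visit v w _ _ (hp.move G hwS (hS a ha v hv)) hvw (by simp [partialLabeling, hwS])

omit [Fintype V] in
theorem partialLabeling_singleton (v : V) :
    partialLabeling {v} (fun _ => 1) = Function.update (fun _ => none) v (some 1) := by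
  funext x
  by_cases hx : x = v
  · subst hx; simp [partialLabeling]
  · simp [partialLabeling, hx]

/-- The inclusion of completions is the invariant: revisits leave it unchanged, and a visit selects
one member of the union. At a total labeling `r = 0`, and it becomes membership. -/
theorem RandomWalkProcess.exists_completions {a : V} {i : ℕ} {lab : V → Option ℕ}
    (hp : RandomWalkProcess G a i lab) :
    ∃ (v : V) (S : Finset V) (l : V → ℕ) (r : ℕ), a ∈ S ∧ i = S.card ∧ lab = partialLabeling S l ∧
      S.card + r = Fintype.card V ∧
      completions G r S l ⊆ completions G (Fintype.card V - 1) {v} (fun _ => 1) := by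
  induction hp with
  | start v =>
    have : 0 < Fintype.card V := Fintype.card_pos_iff.2 ⟨v⟩
    exact ⟨v, {v}, fun _ => 1, Fintype.card V - 1, by simp, by simp,
      (partialLabeling_singleton v).symm, by simp; omega, subset_rfl⟩
  | revisit v w u i lab _ _ _ hw ih =>
    obtain ⟨x, S, l, r, _, h2, h3, h4, h5⟩ := ih
    refine ⟨x, S, l, r, ?_, h2, h3, h4, h5⟩
    by_contra hwS
    exact hw (by simp [h3, partialLabeling, hwS])
  | visit v w i lab _ hvw hw ih =>
    obtain ⟨x, S, l, r, h1, h2, h3, h4, h5⟩ := ih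
    have hwS : w ∉ S := by
      intro hwS; simp [h3, partialLabeling, hwS] at hw
    have hlt : S.card < Fintype.card V := by
      have := Finset.card_le_univ (insert w S)
      rw [Finset.card_insert_of_notMem hwS] at this
      omega
    obtain ⟨r, rfl⟩ : ∃ r', r = r' + 1 := ⟨r - 1, by omega⟩
    have hc := Finset.card_insert_of_notMem hwS
    refine ⟨x, insert w S, Function.update l w (S.card + 1), r, Finset.mem_insert_self _ _,
      by omega, by rw [partialLabeling_insert, h3, h2], by omega, subset_trans ?_ h5⟩
    rw [completions]
    exact Finset.subset_biUnion_of_mem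
      (fun w => completions G r (insert w S) (Function.update l w (S.card + 1)))
      ((mem_outerBoundary G).2 ⟨hwS, v, h1, hvw⟩)

theorem isRandomWalkLabeling_iff (l : V → ℕ) :
    IsRandomWalkLabeling G l ↔
      ∃ v, l ∈ completions G (Fintype.card V - 1) {v} (fun _ => 1) := by
  constructor
  · rintro ⟨a, i, hp⟩
    obtain ⟨v, S, l', r, -, -, h3, h4, h5⟩ := hp.exists_completions G
    have hS : S = Finset.univ := by
      ext x
      have := congrFun h3 x
      by_contra hx
      simp_all [partialLabeling]
    subst hS
    obtain rfl : r = 0 := by simpa using h4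
    refine ⟨v, h5 ?_⟩
    simp only [completions, Finset.mem_singleton]
    funext x
    simpa [partialLabeling] using congrFun h3 x
  · rintro ⟨v, h⟩
    have : 0 < Fintype.card V := Fintype.card_pos_iff.2 ⟨v⟩
    refine isRandomWalkLabeling_of_mem_completions G _ {v} (fun _ => 1) l v (by simp; omega)
      (by simp) ?_ ?_ h
    · intro a ha b hb
      rw [Finset.mem_singleton.1 ha, Finset.mem_singleton.1 hb]
    · rw [partialLabeling_singleton]
      exact .start v

theorem numRandomWalkLabelings_eq_sum :
    numRandomWalkLabelings G = ∑ v, numCompletions G (Fintype.card V - 1) {v} := by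
  have hset : {l : V → ℕ | IsRandomWalkLabeling G l} = ((Finset.univ.biUnion fun v =>
      completions G (Fintype.card V - 1) {v} (fun _ => 1) : Finset (V → ℕ)) : Set (V → ℕ)) := by
    ext l
    simp [isRandomWalkLabeling_iff]
  have hc (v : V) : ({v} : Finset V).card + (Fintype.card V - 1) = Fintype.card V := by
    have : 0 < Fintype.card V := Fintype.card_pos_iff.2 ⟨v⟩
    simp; omega
  rw [numRandomWalkLabelings, hset, Set.ncard_coe_finset, Finset.card_biUnion]
  · exact Finset.sum_congr rfl fun v _ => card_completions G _ _ _ (hc v)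
  · intro v _ w _ hne
    rw [Function.onFun, Finset.disjoint_left]
    intro l h h'
    have h1 := (completions_spec G _ _ _ _ (hc v) h).1 v (Finset.mem_singleton_self v)
    have h2 := (completions_spec G _ _ _ _ (hc w) h').2 v (by simpa using hne)
    simp at h2
    omega

/-- If every unvisited vertex always has a visited neighbor, all orders are possible. -/
theorem numCompletions_eq_factorial (r : ℕ) (S : Finset V) (hr : Sᶜ.card = r)
    (h : ∀ w ∉ S, ∃ v ∈ S, G.Adj v w) : numCompletions G r S = r.factorial := by
  induction r generalizing S with
  | zero => simp [numCompletions]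
  | succ r ih =>
    have hb : outerBoundary G S = Sᶜ := by
      ext w
      rw [mem_outerBoundary, Finset.mem_compl]
      exact ⟨fun h => h.1, fun hw => ⟨hw, h w hw⟩⟩
    rw [numCompletions, Finset.sum_congr rfl (g := fun _ => r.factorial), Finset.sum_const, hb, hr,
      Nat.factorial_succ, smul_eq_mul]
    intro w hw
    rw [hb, Finset.mem_compl] at hw
    refine ih _ ?_ fun x hx => ?_
    · rw [Finset.card_compl, Finset.card_insert_of_notMem hw]
      rw [Finset.card_compl] at hr
      omega
    · obtain ⟨v, hv, hvx⟩ := h x fun hx' => hx (Finset.mem_insert_of_mem hx')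
      exact ⟨v, Finset.mem_insert_of_mem hv, hvx⟩

end Completions

/-! ### The weight of an arc and its recursions -/

/-- The probability that a uniformly random order of the unvisited cells of a circular ladder is
admissible, where `m` consecutive rungs are untouched, and `a₀, a₁` and `b₀, b₁` indicate the
visited cells on the two touched rungs next to them. -/
noncomputable def arcWeight (m : ℕ) (a₀ a₁ b₀ b₁ : ℚ) : ℚ :=
  -- This interpolates four cases. With `x = m + 1`, the value times `x!` is `x(x - 1)` if both
  -- border rungs are full, `x² / 2` if one is, and, with one visited cell on each, `x(x + 1) / 4`
  -- in the same row and `(x² + x + 2) / 4` in opposite rows.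
  ((a₀ + a₁) * (b₀ + b₁) * ((m : ℚ) + 1) ^ 2 +
    (2 * (a₀ + a₁ + b₀ + b₁) - 3 * ((a₀ + a₁) * (b₀ + b₁))) * ((m : ℚ) + 1) +
    (4 - 2 * (a₀ + a₁ + b₀ + b₁) + 2 * ((a₀ + a₁) * (b₀ + b₁)) - 2 * (a₀ * b₀ + a₁ * b₁))) /
  (4 * ((m + 1).factorial : ℚ))

/-- Conditioning on the next cell, with `u` holes and `m + 2` untouched rungs. Filling a hole
changes the weight only on a border rung; entering the arc makes the entered rung the new border,
with a single visited cell. -/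
theorem arcWeight_succ_succ (m : ℕ) (u : ℚ) {a₀ a₁ b₀ b₁ : ℚ} (ha₀ : a₀ = 0 ∨ a₀ = 1)
    (ha₁ : a₁ = 0 ∨ a₁ = 1) (hb₀ : b₀ = 0 ∨ b₀ = 1) (hb₁ : b₁ = 0 ∨ b₁ = 1)
    (ha : a₀ = 1 ∨ a₁ = 1) (hb : b₀ = 1 ∨ b₁ = 1) :
    (2 * ((m + 1 + 1 : ℕ) : ℚ) + u) * arcWeight (m + 2) a₀ a₁ b₀ b₁ =
      u * arcWeight (m + 2) a₀ a₁ b₀ b₁ +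
      (1 - a₀) * (arcWeight (m + 2) 1 a₁ b₀ b₁ - arcWeight (m + 2) a₀ a₁ b₀ b₁) +
      (1 - a₁) * (arcWeight (m + 2) a₀ 1 b₀ b₁ - arcWeight (m + 2) a₀ a₁ b₀ b₁) +
      (1 - b₀) * (arcWeight (m + 2) a₀ a₁ 1 b₁ - arcWeight (m + 2) a₀ a₁ b₀ b₁) +
      (1 - b₁) * (arcWeight (m + 2) a₀ a₁ b₀ 1 - arcWeight (m + 2) a₀ a₁ b₀ b₁) +
      (a₀ * arcWeight (m + 1) 1 0 b₀ b₁ + a₁ * arcWeight (m + 1) 0 1 b₀ b₁) +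
      (b₀ * arcWeight (m + 1) a₀ a₁ 1 0 + b₁ * arcWeight (m + 1) a₀ a₁ 0 1) := by
  have hf : ((m + 2).factorial : ℚ) ≠ 0 := by positivity
  have hm : (m : ℚ) + 3 ≠ 0 := by positivity
  have h3 : ((m + 2 + 1).factorial : ℚ) = ((m : ℚ) + 3) * ((m + 2).factorial : ℚ) := by
    rw [Nat.factorial_succ (m + 2)]; push_cast; ring
  simp only [arcWeight, h3, show m + 1 + 1 = m + 2 from rfl]
  push_cast
  rcases ha₀ with rfl | rfl <;> rcases ha₁ with rfl | rfl <;> rcases hb₀ with rfl | rfl <;>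
    rcases hb₁ with rfl | rfl <;> first | (exfalso; simp_all; done) | (field_simp; ring)

/-- A single untouched rung can be entered from both sides, whence the inclusion-exclusion terms;
once it is entered, every order is admissible and the weight is `1`. -/
theorem arcWeight_one (u : ℚ) {a₀ a₁ b₀ b₁ : ℚ} (ha₀ : a₀ = 0 ∨ a₀ = 1)
    (ha₁ : a₁ = 0 ∨ a₁ = 1) (hb₀ : b₀ = 0 ∨ b₀ = 1) (hb₁ : b₁ = 0 ∨ b₁ = 1)
    (ha : a₀ = 1 ∨ a₁ = 1) (hb : b₀ = 1 ∨ b₁ = 1) :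
    (2 + u) * arcWeight 1 a₀ a₁ b₀ b₁ = u * arcWeight 1 a₀ a₁ b₀ b₁ +
      (1 - a₀) * (arcWeight 1 1 a₁ b₀ b₁ - arcWeight 1 a₀ a₁ b₀ b₁) +
      (1 - a₁) * (arcWeight 1 a₀ 1 b₀ b₁ - arcWeight 1 a₀ a₁ b₀ b₁) +
      (1 - b₀) * (arcWeight 1 a₀ a₁ 1 b₁ - arcWeight 1 a₀ a₁ b₀ b₁) +
      (1 - b₁) * (arcWeight 1 a₀ a₁ b₀ 1 - arcWeight 1 a₀ a₁ b₀ b₁) +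
      ((a₀ + b₀ - a₀ * b₀) + (a₁ + b₁ - a₁ * b₁)) := by
  simp only [arcWeight, Nat.factorial]
  rcases ha₀ with rfl | rfl <;> rcases ha₁ with rfl | rfl <;> rcases hb₀ with rfl | rfl <;>
    rcases hb₁ with rfl | rfl <;> first | (exfalso; simp_all; done) | (norm_num; done) | (norm_num; ring)

/-! ### Arcs of untouched rungs and their boundary -/

/-- The circular ladder with `k + 2` rungs. -/
abbrev circularLadder (k : ℕ) : SimpleGraph (Fin 2 × Fin (k + 2)) :=
  SimpleGraph.boxProd (SimpleGraph.cycleGraph 2) (SimpleGraph.cycleGraph (k + 2))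

section CircularLadder

variable {k : ℕ}

theorem circularLadder_adj (v w : Fin 2 × Fin (k + 2)) :
    (circularLadder k).Adj v w ↔
      (v.1 ≠ w.1 ∧ v.2 = w.2) ∨ (v.1 = w.1 ∧ (w.2 = v.2 + 1 ∨ v.2 = w.2 + 1)) := by
  rw [SimpleGraph.boxProd_adj, SimpleGraph.cycleGraph_two_eq_top, SimpleGraph.top_adj,
    SimpleGraph.cycleGraph_adj, sub_eq_iff_eq_add, sub_eq_iff_eq_add, add_comm 1, add_comm 1]
  tauto

/-- The untouched rungs of `S` are `s, s + 1, …, e - 1`; if all rungs but one are untouched, then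
the remaining one is completely visited. -/
structure IsArc (S : Finset (Fin 2 × Fin (k + 2))) (s e : Fin (k + 2)) : Prop where
  ne : e ≠ s
  untouched : ∀ i r, (i - s).val < (e - s).val → (r, i) ∉ S
  touched : ∀ i, (e - s).val ≤ (i - s).val → ∃ r, (r, i) ∈ S
  full : e = s - 1 → ∀ r, (r, e) ∈ S

theorem val_sub_one {t : Fin (k + 2)} (h : t ≠ 0) : (t - 1).val + 1 = t.val := by
  rw [Fin.coe_sub_one, if_neg h]
  have : t.val ≠ 0 := fun h' => h (Fin.ext h')
  omega

/-- Rungs are located by their cyclic offset `(i - s).val`; excluding `i = s` avoids the only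
wraparound. -/
theorem val_sub_succ {s i : Fin (k + 2)} (h : i ≠ s) : (i - (s + 1)).val + 1 = (i - s).val := by
  rw [sub_add_eq_sub_sub]
  exact val_sub_one (sub_ne_zero.2 h)

theorem val_pred_sub {s i : Fin (k + 2)} (h : i ≠ s) : (i - 1 - s).val + 1 = (i - s).val := by
  rw [sub_right_comm]
  exact val_sub_one (sub_ne_zero.2 h)

theorem val_self_sub_succ (s : Fin (k + 2)) : (s - (s + 1)).val = k + 1 := by
  rw [sub_add_eq_sub_sub, sub_self, Fin.coe_sub_one, if_pos rfl]

theorem val_pred_sub_self (s : Fin (k + 2)) : (s - 1 - s).val = k + 1 := by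
  rw [sub_right_comm, sub_self, Fin.coe_sub_one, if_pos rfl]

theorem val_self_sub (s : Fin (k + 2)) : (s - s).val = 0 := by
  rw [sub_self, Fin.val_zero]

theorem val_sub_inj {s i j : Fin (k + 2)} : (i - s).val = (j - s).val ↔ i = j := by
  rw [Fin.val_inj, sub_left_inj]

theorem val_sub_pos {s i : Fin (k + 2)} (h : i ≠ s) : 0 < (i - s).val := by
  have := val_sub_succ h
  omega

namespace IsArc

variable {S : Finset (Fin 2 × Fin (k + 2))} {s e : Fin (k + 2)}

theorem pred_touched (e s : Fin (k + 2)) : (e - s).val ≤ (s - 1 - s).val := by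
  rw [val_pred_sub_self]; omega

theorem insert_left (h : IsArc S s e) (he : e ≠ s + 1) (r : Fin 2) :
    IsArc (insert (r, s) S) (s + 1) e where
  ne := he
  untouched i r' hi := by
    have h1 := val_sub_succ h.ne
    have his : i ≠ s := by
      rintro rfl
      rw [val_self_sub_succ] at hi
      omega
    have h2 := val_sub_succ his
    simp [his, h.untouched i r' (by omega)]
  touched i hi := by
    by_cases his : i = s
    · exact ⟨r, by simp [his]⟩
    · have h1 := val_sub_succ h.ne
      have h2 := val_sub_succ his
      obtain ⟨r', hr'⟩ := h.touched i (by omega)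
      exact ⟨r', Finset.mem_insert_of_mem hr'⟩
  full h' := by
    rw [add_sub_cancel_right] at h'
    exact absurd h' h.ne

theorem insert_right (h : IsArc S s e) (he : e ≠ s + 1) (r : Fin 2) :
    IsArc (insert (r, e - 1) S) s (e - 1) where
  ne := by rwa [Ne, sub_eq_iff_eq_add]
  untouched i r' hi := by
    have h1 := val_pred_sub h.ne
    have hie : i ≠ e - 1 := by
      rintro rfl
      omega
    simp [hie, h.untouched i r' (by omega)]
  touched i hi := by
    by_cases hie : i = e - 1
    · exact ⟨r, by simp [hie]⟩
    · have h1 := val_pred_sub h.ne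
      have h2 := mt (val_sub_inj (s := s)).1 hie
      obtain ⟨r', hr'⟩ := h.touched i (by omega)
      exact ⟨r', Finset.mem_insert_of_mem hr'⟩
  full h' := absurd (sub_left_inj.1 h') h.ne

theorem insert_touched (h : IsArc S s e) {w : Fin 2 × Fin (k + 2)}
    (hw : (e - s).val ≤ (w.2 - s).val) : IsArc (insert w S) s e where
  ne := h.ne
  untouched i r hi := by
    have : (r, i) ≠ w := by
      rintro rfl
      simp at hw
      omega
    simp [this, h.untouched i r hi]
  touched i hi := by
    obtain ⟨r', hr'⟩ := h.touched i hi
    exact ⟨r', Finset.mem_insert_of_mem hr'⟩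
  full h' r := Finset.mem_insert_of_mem (h.full h' r)

theorem adj_of_touched (h : IsArc S s e) {w : Fin 2 × Fin (k + 2)} (hwS : w ∉ S)
    (hw : (e - s).val ≤ (w.2 - s).val) : ∃ v ∈ S, (circularLadder k).Adj v w := by
  obtain ⟨r, hr⟩ := h.touched _ hw
  refine ⟨_, hr, (circularLadder_adj _ _).2 (Or.inl ⟨?_, rfl⟩)⟩
  rintro rfl
  exact hwS hr

/-- A hole has a visited neighbor on its own rung. A cell of an untouched rung can be reached only
along its row, from a border rung. -/
theorem mem_outerBoundary_iff (h : IsArc S s e) (w : Fin 2 × Fin (k + 2)) :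
    w ∈ outerBoundary (circularLadder k) S ↔
      (w ∉ S ∧ (e - s).val ≤ (w.2 - s).val) ∨
        (w.2 = s ∧ (w.1, s - 1) ∈ S) ∨ (w.2 = e - 1 ∧ (w.1, e) ∈ S) := by
  obtain ⟨r, i⟩ := w
  rw [mem_outerBoundary]
  constructor
  · rintro ⟨hw, ⟨r', j⟩, hv, hadj⟩
    refine or_iff_not_imp_left.2 fun hi => ?_
    simp only [hw, not_false_eq_true, true_and, not_le] at hi
    have hj : (e - s).val ≤ (j - s).val := by
      by_contra hj
      exact h.untouched j r' (by omega) hv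
    rcases (circularLadder_adj _ _).1 hadj with ⟨-, h2⟩ | ⟨h1, h2 | h2⟩
    · simp only at h2; subst h2; omega
    · simp only at h1 h2
      subst h1 h2
      left
      by_cases hs : j + 1 = s
      · refine ⟨hs, ?_⟩
        rwa [← hs, add_sub_cancel_right]
      · have := val_pred_sub hs
        rw [add_sub_cancel_right] at this
        omega
    · simp only at h1 h2
      subst h1 h2
      right
      have hie : i + 1 = e := by
        by_cases hs : i + 1 = s
        · rw [hs, val_self_sub] at hj
          have := val_sub_pos h.ne
          omega
        · have := val_pred_sub hs
          rw [add_sub_cancel_right] at this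
          rw [← val_sub_inj (s := s)]
          omega
      subst hie
      exact ⟨(add_sub_cancel_right _ _).symm, hv⟩
  · rintro (⟨hw, hi⟩ | ⟨rfl, hv⟩ | ⟨rfl, hv⟩)
    · exact ⟨hw, h.adj_of_touched hw hi⟩
    · refine ⟨h.untouched _ _ ?_, _, hv, (circularLadder_adj _ _).2 (Or.inr ⟨rfl, Or.inl ?_⟩)⟩
      · simpa using val_sub_pos h.ne
      · simp
    · refine ⟨h.untouched _ _ ?_, _, hv, (circularLadder_adj _ _).2 (Or.inr ⟨rfl, Or.inr ?_⟩)⟩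
      · have := val_pred_sub h.ne
        omega
      · simp

/-- The unvisited cells on the touched rungs. -/
def holes (S : Finset (Fin 2 × Fin (k + 2))) (s e : Fin (k + 2)) : Finset (Fin 2 × Fin (k + 2)) :=
  Finset.univ.filter fun w => w ∉ S ∧ (e - s).val ≤ (w.2 - s).val

theorem mem_holes {w : Fin 2 × Fin (k + 2)} :
    w ∈ holes S s e ↔ w ∉ S ∧ (e - s).val ≤ (w.2 - s).val := by
  simp [holes]

theorem card_compl (h : IsArc S s e) : Sᶜ.card = 2 * (e - s).val + (holes S s e).card := by
  have hsplit : Sᶜ = holes S s e ∪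
      Finset.univ ×ˢ (Finset.univ.filter fun i => (i - s).val < (e - s).val) := by
    ext ⟨r, i⟩
    have := h.untouched i r
    simp only [Finset.mem_compl, Finset.mem_union, mem_holes, Finset.mem_product,
      Finset.mem_univ, Finset.mem_filter, true_and]
    grind
  have hcard : (Finset.univ.filter fun i => (i - s).val < (e - s).val).card = (e - s).val := by
    have := Fin.card_filter_val_lt (n := k + 2) (m := (e - s).val)
    rw [min_eq_right (e - s).isLt.le] at this
    refine Eq.trans ?_ this
    refine Finset.card_bij (fun i _ => i - s) ?_ ?_ ?_
    · intro i hi; simpa using hi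
    · intro i _ j _ hij; exact sub_left_inj.1 hij
    · intro t ht; exact ⟨t + s, by simpa using ht, by simp⟩
  rw [hsplit, Finset.card_union_of_disjoint, Finset.card_product, hcard]
  · simp [add_comm]
  · rw [Finset.disjoint_left]
    rintro ⟨r, i⟩ h1 h2
    simp only [mem_holes, Finset.mem_product, Finset.mem_univ, Finset.mem_filter, true_and] at h1 h2
    omega

theorem sum_outerBoundary (h : IsArc S s e) (he : e ≠ s + 1) (F : Fin 2 × Fin (k + 2) → ℚ) :
    ∑ w ∈ outerBoundary (circularLadder k) S, F w = ∑ w ∈ holes S s e, F w +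
      (∑ r, if (r, s - 1) ∈ S then F (r, s) else 0) +
      (∑ r, if (r, e) ∈ S then F (r, e - 1) else 0) := by
  have hb : outerBoundary (circularLadder k) S = holes S s e ∪
      ((Finset.univ.filter fun r : Fin 2 => (r, s - 1) ∈ S) ×ˢ {s}) ∪
      ((Finset.univ.filter fun r : Fin 2 => (r, e) ∈ S) ×ˢ {e - 1}) := by
    ext ⟨r, i⟩
    rw [h.mem_outerBoundary_iff]
    simp only [Finset.mem_union, mem_holes, Finset.mem_product, Finset.mem_univ,
      Finset.mem_filter, true_and, Finset.mem_singleton]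
    tauto
  have hse : e - 1 ≠ s := by rwa [Ne, sub_eq_iff_eq_add]
  have h0 := val_sub_pos h.ne
  have h1 := val_pred_sub h.ne
  rw [hb, Finset.sum_union, Finset.sum_union, Finset.sum_product, Finset.sum_product,
    Finset.sum_filter, Finset.sum_filter]
  · simp
  · rw [Finset.disjoint_left]
    rintro ⟨r, i⟩ h2 h3
    simp only [mem_holes, Finset.mem_product, Finset.mem_singleton] at h2 h3
    obtain ⟨-, rfl⟩ := h3
    rw [val_self_sub] at h2
    omega
  · rw [Finset.disjoint_left]
    rintro ⟨r, i⟩ h2 h3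
    simp only [mem_holes, Finset.mem_product, Finset.mem_singleton, Finset.mem_union] at h2 h3
    obtain ⟨-, rfl⟩ := h3
    rcases h2 with ⟨_, h2⟩ | ⟨_, h2⟩
    · omega
    · exact hse h2

theorem sum_outerBoundary_of_eq (h : IsArc S s e) (he : e = s + 1) (F : Fin 2 × Fin (k + 2) → ℚ) :
    ∑ w ∈ outerBoundary (circularLadder k) S, F w = ∑ w ∈ holes S s e, F w +
      ∑ r, if (r, s - 1) ∈ S ∨ (r, e) ∈ S then F (r, s) else 0 := by
  have hse : e - 1 = s := by rw [he, add_sub_cancel_right]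
  have hb : outerBoundary (circularLadder k) S = holes S s e ∪
      ((Finset.univ.filter fun r : Fin 2 => (r, s - 1) ∈ S ∨ (r, e) ∈ S) ×ˢ {s}) := by
    ext ⟨r, i⟩
    rw [h.mem_outerBoundary_iff, hse]
    simp only [Finset.mem_union, mem_holes, Finset.mem_product, Finset.mem_univ,
      Finset.mem_filter, true_and, Finset.mem_singleton]
    tauto
  have h0 := val_sub_pos h.ne
  rw [hb, Finset.sum_union, Finset.sum_product, Finset.sum_filter]
  · simp
  · rw [Finset.disjoint_left]
    rintro ⟨r, i⟩ h2 h3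
    simp only [mem_holes, Finset.mem_product, Finset.mem_singleton] at h2 h3
    obtain ⟨-, rfl⟩ := h3
    rw [val_self_sub] at h2
    omega

end IsArc

/-! ### Weights of visited sets and the count of completions -/

/-- The indicator of the cell `c` being visited. -/
def visited (S : Finset (Fin 2 × Fin (k + 2))) (c : Fin 2 × Fin (k + 2)) : ℚ :=
  if c ∈ S then 1 else 0

/-- The value of `arcWeight` for the set `S` of visited cells and the untouched rungs
`s, s + 1, …, e - 1`. -/
noncomputable def setWeight (S : Finset (Fin 2 × Fin (k + 2))) (s e : Fin (k + 2)) : ℚ :=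
  arcWeight (e - s).val (visited S (0, s - 1)) (visited S (1, s - 1)) (visited S (0, e))
    (visited S (1, e))

theorem visited_eq (S : Finset (Fin 2 × Fin (k + 2))) (c : Fin 2 × Fin (k + 2)) :
    visited S c = 0 ∨ visited S c = 1 := by
  unfold visited; split_ifs <;> simp

theorem visited_of_mem {S : Finset (Fin 2 × Fin (k + 2))} {c : Fin 2 × Fin (k + 2)} (h : c ∈ S) :
    visited S c = 1 := if_pos h

theorem visited_insert_self (S : Finset (Fin 2 × Fin (k + 2))) (c : Fin 2 × Fin (k + 2)) :
    visited (insert c S) c = 1 := visited_of_mem (Finset.mem_insert_self _ _)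

theorem visited_insert_of_ne (S : Finset (Fin 2 × Fin (k + 2))) {c w : Fin 2 × Fin (k + 2)}
    (h : c ≠ w) : visited (insert w S) c = visited S c := by
  simp [visited, h]

namespace IsArc

variable {S : Finset (Fin 2 × Fin (k + 2))} {s e : Fin (k + 2)}

theorem visited_left (h : IsArc S s e) :
    visited S (0, s - 1) = 1 ∨ visited S (1, s - 1) = 1 := by
  obtain ⟨r, hr⟩ := h.touched (s - 1) (pred_touched e s)
  have := visited_of_mem hr
  fin_cases r
  · exact Or.inl this
  · exact Or.inr this

theorem visited_right (h : IsArc S s e) : visited S (0, e) = 1 ∨ visited S (1, e) = 1 := by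
  obtain ⟨r, hr⟩ := h.touched e le_rfl
  have := visited_of_mem hr
  fin_cases r
  · exact Or.inl this
  · exact Or.inr this

theorem sum_holes_ite {c : Fin 2 × Fin (k + 2)} (hc : (e - s).val ≤ (c.2 - s).val) (x : ℚ) :
    ∑ w ∈ holes S s e, (if c = w then x else 0) = (1 - visited S c) * x := by
  rw [Finset.sum_ite_eq]
  simp only [mem_holes, hc, and_true, visited]
  split_ifs <;> simp_all

/-- At most one correction is active. If both borders are the same rung, `IsArc.full` leaves no hole
there, so no cell is counted on both sides. -/
theorem setWeight_insert_hole (h : IsArc S s e) {w : Fin 2 × Fin (k + 2)} (hw : w ∈ holes S s e)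
    {m : ℕ} (hm : (e - s).val = m) {a₀ a₁ b₀ b₁ : ℚ} (ha₀ : visited S (0, s - 1) = a₀)
    (ha₁ : visited S (1, s - 1) = a₁) (hb₀ : visited S (0, e) = b₀) (hb₁ : visited S (1, e) = b₁) :
    setWeight (insert w S) s e = arcWeight m a₀ a₁ b₀ b₁ +
      (if (0, s - 1) = w then arcWeight m 1 a₁ b₀ b₁ - arcWeight m a₀ a₁ b₀ b₁ else 0) +
      (if (1, s - 1) = w then arcWeight m a₀ 1 b₀ b₁ - arcWeight m a₀ a₁ b₀ b₁ else 0) +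
      (if (0, e) = w then arcWeight m a₀ a₁ 1 b₁ - arcWeight m a₀ a₁ b₀ b₁ else 0) +
      (if (1, e) = w then arcWeight m a₀ a₁ b₀ 1 - arcWeight m a₀ a₁ b₀ b₁ else 0) := by
  have hwS := (mem_holes.1 hw).1
  rw [setWeight, hm]
  by_cases hes : e = s - 1
  · have hne : ∀ r, (r, e) ≠ w := fun r hr => hwS (hr ▸ h.full hes r)
    rw [← hes] at ha₀ ha₁ ⊢
    rw [visited_insert_of_ne _ (hne 0), visited_insert_of_ne _ (hne 1), ha₀, ha₁]
    rw [ha₀] at hb₀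
    rw [ha₁] at hb₁
    simp [hne, hb₀, hb₁]
  · have hes' : s - 1 ≠ e := fun h' => hes h'.symm
    by_cases h1 : (0, s - 1) = w
    · subst h1
      simp [visited_insert_self, visited_insert_of_ne, hes, ha₁, hb₀, hb₁]
    by_cases h2 : (1, s - 1) = w
    · subst h2
      simp [visited_insert_self, visited_insert_of_ne, hes, ha₀, hb₀, hb₁]
    by_cases h3 : (0, e) = w
    · subst h3
      simp [visited_insert_self, visited_insert_of_ne, hes', ha₀, ha₁, hb₁]
    by_cases h4 : (1, e) = w
    · subst h4
      simp [visited_insert_self, visited_insert_of_ne, hes', ha₀, ha₁, hb₀]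
    simp [visited_insert_of_ne _ h1, visited_insert_of_ne _ h2, visited_insert_of_ne _ h3,
      visited_insert_of_ne _ h4, h1, h2, h3, h4, ha₀, ha₁, hb₀, hb₁]

theorem sum_setWeight_insert_hole (h : IsArc S s e)
    {m : ℕ} (hm : (e - s).val = m) {a₀ a₁ b₀ b₁ : ℚ} (ha₀ : visited S (0, s - 1) = a₀)
    (ha₁ : visited S (1, s - 1) = a₁) (hb₀ : visited S (0, e) = b₀) (hb₁ : visited S (1, e) = b₁) :
    ∑ w ∈ holes S s e, setWeight (insert w S) s e =
      ((holes S s e).card : ℚ) * arcWeight m a₀ a₁ b₀ b₁ +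
      (1 - a₀) * (arcWeight m 1 a₁ b₀ b₁ - arcWeight m a₀ a₁ b₀ b₁) +
      (1 - a₁) * (arcWeight m a₀ 1 b₀ b₁ - arcWeight m a₀ a₁ b₀ b₁) +
      (1 - b₀) * (arcWeight m a₀ a₁ 1 b₁ - arcWeight m a₀ a₁ b₀ b₁) +
      (1 - b₁) * (arcWeight m a₀ a₁ b₀ 1 - arcWeight m a₀ a₁ b₀ b₁) := by
  rw [Finset.sum_congr rfl fun w hw => h.setWeight_insert_hole hw hm ha₀ ha₁ hb₀ hb₁]
  simp only [Finset.sum_add_distrib, Finset.sum_const, nsmul_eq_mul]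
  rw [sum_holes_ite (pred_touched e s), sum_holes_ite (pred_touched e s), sum_holes_ite (c := (0, e)) le_rfl,
    sum_holes_ite (c := (1, e)) le_rfl, ha₀, ha₁, hb₀, hb₁]

theorem setWeight_insert_left (h : IsArc S s e) {m : ℕ} (hm : (e - s).val = m + 1) (r : Fin 2) :
    setWeight (insert (r, s) S) (s + 1) e =
      arcWeight m (if r = 0 then 1 else 0) (if r = 1 then 1 else 0) (visited S (0, e))
        (visited S (1, e)) := by
  have h1 := val_sub_succ h.ne
  have hs : ∀ r, (r, s) ∉ S := fun r => h.untouched s r (by simpa using val_sub_pos h.ne)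
  have hne := h.ne
  rw [setWeight, show (e - (s + 1)).val = m by omega, add_sub_cancel_right,
    visited_insert_of_ne (c := (0, e)) _ (by simp [hne]),
    visited_insert_of_ne (c := (1, e)) _ (by simp [hne])]
  fin_cases r <;> simp [visited, hs]

theorem setWeight_insert_right (h : IsArc S s e) {m : ℕ} (hm : (e - s).val = m + 1) (r : Fin 2) :
    setWeight (insert (r, e - 1) S) s (e - 1) =
      arcWeight m (visited S (0, s - 1)) (visited S (1, s - 1)) (if r = 0 then 1 else 0)
        (if r = 1 then 1 else 0) := by
  have h1 := val_pred_sub h.ne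
  have hs : ∀ r, (r, e - 1) ∉ S := fun r => h.untouched _ r (by omega)
  have hne : s - 1 ≠ e - 1 := fun h' => h.ne (sub_left_inj.1 h').symm
  rw [setWeight, show (e - 1 - s).val = m by omega,
    visited_insert_of_ne (c := (0, s - 1)) _ fun h' => hne (congrArg Prod.snd h'),
    visited_insert_of_ne (c := (1, s - 1)) _ fun h' => hne (congrArg Prod.snd h')]
  fin_cases r <;> simp [visited, hs]

/-- Entering the last untouched rung leaves a visited cell on every rung, so
`numCompletions_eq_factorial` applies. -/
theorem adj_of_insert (h : IsArc S s e) (he : e = s + 1) (r : Fin 2) (w : Fin 2 × Fin (k + 2))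
    (hw : w ∉ insert (r, s) S) : ∃ v ∈ insert (r, s) S, (circularLadder k).Adj v w := by
  by_cases hws : w.2 = s
  · refine ⟨(r, s), Finset.mem_insert_self _ _, (circularLadder_adj _ _).2 (Or.inl ⟨?_, hws.symm⟩)⟩
    rintro rfl
    exact hw (by rw [← hws]; simp)
  · have h1 : (e - s).val = 1 := by rw [he, add_sub_cancel_left]; simp
    have h2 := val_sub_pos hws
    obtain ⟨v, hv, hvw⟩ := h.adj_of_touched (fun h' => hw (Finset.mem_insert_of_mem h'))
      (show (e - s).val ≤ (w.2 - s).val by omega)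
    exact ⟨v, Finset.mem_insert_of_mem hv, hvw⟩

end IsArc

theorem card_compl_insert {S : Finset (Fin 2 × Fin (k + 2))} {w : Fin 2 × Fin (k + 2)} {N : ℕ}
    (hN : Sᶜ.card = N + 1) (hw : w ∉ S) : (insert w S)ᶜ.card = N := by
  rw [Finset.compl_insert, Finset.card_erase_of_mem (by simpa using hw), hN, Nat.add_sub_cancel]

theorem IsArc.numCompletions {S : Finset (Fin 2 × Fin (k + 2))} {s e : Fin (k + 2)}
    (h : IsArc S s e) {N : ℕ} (hN : Sᶜ.card = N) :
    (numCompletions (circularLadder k) N S : ℚ) = (N.factorial : ℚ) * setWeight S s e := by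
  induction N generalizing S s e with
  | zero =>
    have h1 := h.card_compl
    have h2 := val_sub_pos h.ne
    omega
  | succ N ih =>
    have hcard := h.card_compl
    rw [hN] at hcard
    have hcard' : ((N : ℚ) + 1) = 2 * ((e - s).val : ℚ) + ((holes S s e).card : ℚ) := by
      exact_mod_cast hcard
    have hpos := val_sub_pos h.ne
    have hholes : ∑ w ∈ holes S s e,
          (_root_.numCompletions (circularLadder k) N (insert w S) : ℚ) =
        (N.factorial : ℚ) * ∑ w ∈ holes S s e, setWeight (insert w S) s e := by
      rw [Finset.mul_sum]
      refine Finset.sum_congr rfl fun w hw => ?_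
      exact ih (h.insert_touched (mem_holes.1 hw).2) (card_compl_insert hN (mem_holes.1 hw).1)
    have hleft : ∀ r, (r, s) ∉ S := fun r => h.untouched s r (by simpa using hpos)
    rw [_root_.numCompletions, Nat.cast_sum, Nat.factorial_succ]
    push_cast
    by_cases he : e = s + 1
    · have h1 : (e - s).val = 1 := by rw [he, add_sub_cancel_left]; simp
      have hfac : ∀ r, (_root_.numCompletions (circularLadder k) N (insert (r, s) S) : ℚ) =
          N.factorial := fun r => by
        exact_mod_cast numCompletions_eq_factorial _ _ _ (card_compl_insert hN (hleft r))
          (h.adj_of_insert he r)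
      have hor : ∀ r, (if (r, s - 1) ∈ S ∨ (r, e) ∈ S then (N.factorial : ℚ) else 0) =
          N.factorial * (visited S (r, s - 1) + visited S (r, e) -
            visited S (r, s - 1) * visited S (r, e)) := by
        intro r
        by_cases h1 : (r, s - 1) ∈ S <;> by_cases h2 : (r, e) ∈ S <;> simp [visited, h1, h2]
      rw [h.sum_outerBoundary_of_eq he, hholes, h.sum_setWeight_insert_hole h1 rfl rfl rfl rfl,
        Fin.sum_univ_two, hfac, hfac, hor, hor, setWeight, hcard', h1]
      have := arcWeight_one (holes S s e).card (visited_eq S (0, s - 1)) (visited_eq S (1, s - 1))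
        (visited_eq S (0, e)) (visited_eq S (1, e)) h.visited_left h.visited_right
      push_cast
      linear_combination (-(N.factorial : ℚ)) * this
    -- With at least two untouched rungs, the two ends of the arc are distinct, and entering either
    -- one leaves a shorter nonempty arc.
    · obtain ⟨m, hm⟩ : ∃ m, (e - s).val = m + 1 + 1 := by
        refine ⟨(e - s).val - 2, ?_⟩
        have := val_sub_pos he
        have := val_sub_succ h.ne
        omega
      have hright : ∀ r, (r, e - 1) ∉ S := fun r => h.untouched _ r (by
        have := val_pred_sub h.ne
        omega)
      have hF : ∀ r, (_root_.numCompletions (circularLadder k) N (insert (r, s) S) : ℚ) =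
          N.factorial * setWeight (insert (r, s) S) (s + 1) e := fun r =>
        ih (h.insert_left he r) (card_compl_insert hN (hleft r))
      have hF' : ∀ r, (_root_.numCompletions (circularLadder k) N (insert (r, e - 1) S) : ℚ) =
          N.factorial * setWeight (insert (r, e - 1) S) s (e - 1) := fun r =>
        ih (h.insert_right he r) (card_compl_insert hN (hright r))
      have hite : ∀ (c : Fin 2 × Fin (k + 2)) (x : ℚ), (if c ∈ S then x else 0) =
          visited S c * x := by
        intro c x
        by_cases hc : c ∈ S <;> simp [visited, hc]
      rw [h.sum_outerBoundary he, hholes, h.sum_setWeight_insert_hole hm rfl rfl rfl rfl,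
        Fin.sum_univ_two, Fin.sum_univ_two, hF, hF, hF', hF', hite, hite, hite, hite,
        h.setWeight_insert_left hm, h.setWeight_insert_left hm, h.setWeight_insert_right hm,
        h.setWeight_insert_right hm, setWeight, hcard', hm]
      have := arcWeight_succ_succ m (holes S s e).card (visited_eq S (0, s - 1))
        (visited_eq S (1, s - 1)) (visited_eq S (0, e)) (visited_eq S (1, e)) h.visited_left
        h.visited_right
      simp only [if_true, one_ne_zero, zero_ne_one, if_false]
      linear_combination (-(N.factorial : ℚ)) * this

end CircularLadder

/-! ### The first two vertices -/

section CircularLadderStart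

variable {k : ℕ}

theorem fin_two_ne_iff {a b : Fin 2} : a ≠ b ↔ b = a + 1 := by
  revert a b; decide

theorem mem_outerBoundary_singleton (v w : Fin 2 × Fin (k + 2)) :
    w ∈ outerBoundary (circularLadder k) {v} ↔
      w = (v.1 + 1, v.2) ∨ w = (v.1, v.2 + 1) ∨ w = (v.1, v.2 - 1) := by
  obtain ⟨r, i⟩ := v
  obtain ⟨r', j⟩ := w
  have hne : r + 1 ≠ r := (fin_two_ne_iff.2 rfl).symm
  have h1 : i + 1 ≠ i := by simp
  have h2 : i - 1 ≠ i := by simp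
  simp only [mem_outerBoundary, Finset.mem_singleton, exists_eq_left, circularLadder_adj,
    fin_two_ne_iff, Prod.mk.injEq, eq_sub_iff_add_eq, eq_comm (a := i) (b := j + 1)]
  constructor
  · tauto
  · rintro (⟨rfl, rfl⟩ | ⟨rfl, rfl⟩ | ⟨rfl, rfl⟩) <;> simp

theorem fin_two_sub_one (i : Fin 2) : i - 1 = i + 1 := by
  revert i; decide

theorem fin_two_eq_or (i j : Fin 2) : j = i + 1 ∨ j = i := by
  revert i j; decide

theorem isArc_rung (r : Fin 2) (i : Fin (k + 2)) :
    IsArc (insert (r + 1, i) {(r, i)}) (i + 1) i where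
  ne := by simp
  untouched j r' hj := by
    have : j ≠ i := by
      rintro rfl
      omega
    simp [this]
  touched j hj := by
    have h1 := val_self_sub_succ i
    have : j = i := by
      rw [← val_sub_inj (s := i + 1)]
      omega
    exact ⟨r, by simp [this]⟩
  full _ r' := by
    by_cases h : r = r'
    · simp [h]
    · simp [fin_two_ne_iff.1 h]

/-- For `k = 0` the pair already touches both rungs and no arc remains. -/
theorem isArc_pair (hk : 0 < k) (r : Fin 2) (i : Fin (k + 2)) :
    IsArc (insert (r, i + 1) {(r, i)}) (i + 1 + 1) i := by
  have h1 := val_self_sub_succ i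
  have h2 := val_sub_succ (s := i + 1) (i := i) (by simp)
  have hne : i ≠ i + 1 + 1 := by
    intro h
    rw [← h, val_self_sub] at h2
    omega
  refine ⟨hne, fun j r' hj => ?_, fun j hj => ?_, fun h => ?_⟩
  · have hji : j ≠ i := by
      rintro rfl
      omega
    have hji' : j ≠ i + 1 := by
      rintro rfl
      rw [val_self_sub_succ (i + 1)] at hj
      omega
    simp [hji, hji']
  · refine ⟨r, ?_⟩
    by_cases hji : j = i + 1
    · simp [hji]
    · have h3 := val_sub_succ hji
      have : j = i := by
        rw [← val_sub_inj (s := i + 1)]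
        omega
      simp [this]
  · rw [add_sub_cancel_right] at h
    simp at h

theorem setWeight_rung (r : Fin 2) (i : Fin (k + 2)) :
    setWeight (insert (r + 1, i) {(r, i)}) (i + 1) i = 1 / (k.factorial : ℚ) := by
  have h := isArc_rung r i
  have hv : ∀ r', visited (insert (r + 1, i) {(r, i)}) (r', i) = 1 := fun r' =>
    visited_of_mem (h.full (add_sub_cancel_right _ _).symm r')
  rw [setWeight, val_self_sub_succ, add_sub_cancel_right, hv, hv, arcWeight,
    Nat.factorial_succ (k + 1), Nat.factorial_succ k]
  have : (k.factorial : ℚ) ≠ 0 := by positivity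
  have : (k : ℚ) + 1 ≠ 0 := by positivity
  have : (k : ℚ) + 1 + 1 ≠ 0 := by positivity
  push_cast
  field_simp
  ring

theorem setWeight_pair (r : Fin 2) (i : Fin (k + 2)) :
    setWeight (insert (r, i + 1) {(r, i)}) (i + 1 + 1) i =
      ((k : ℚ) + 2) / (4 * (k.factorial : ℚ)) := by
  have h2 := val_sub_succ (s := i + 1) (i := i) (by simp)
  rw [val_self_sub_succ] at h2
  have hf : (k.factorial : ℚ) ≠ 0 := by positivity
  have hk : (k : ℚ) + 1 ≠ 0 := by positivity
  rw [setWeight, show (i - (i + 1 + 1)).val = k by omega, add_sub_cancel_right, arcWeight,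
    Nat.factorial_succ k]
  push_cast
  fin_cases r <;> simp [visited] <;> field_simp <;> ring

theorem card_compl_pair {v w : Fin 2 × Fin (k + 2)} (h : w ≠ v) :
    (insert w {v} : Finset (Fin 2 × Fin (k + 2)))ᶜ.card = 2 * k + 2 := by
  rw [Finset.card_compl, Finset.card_pair h, Fintype.card_prod, Fintype.card_fin, Fintype.card_fin]
  omega

theorem numCompletions_pair (hk : 0 < k) (r : Fin 2) (i : Fin (k + 2)) :
    (numCompletions (circularLadder k) (2 * k + 2) (insert (r, i + 1) {(r, i)}) : ℚ) =
      ((2 * k + 2).factorial : ℚ) * (((k : ℚ) + 2) / (4 * (k.factorial : ℚ))) := by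
  rw [(isArc_pair hk r i).numCompletions (card_compl_pair (by simp)), setWeight_pair]

/-- A single vertex violates `IsArc.full`, so the first step is taken by hand and the arc count is
used from two vertices on. -/
theorem numCompletions_singleton (v : Fin 2 × Fin (k + 2)) :
    (numCompletions (circularLadder k) (2 * k + 3) {v} : ℚ) =
      ((k : ℚ) + 4) / 2 * ((2 * k + 2).factorial : ℚ) / (k.factorial : ℚ) := by
  obtain ⟨r, i⟩ := v
  have hf : (k.factorial : ℚ) ≠ 0 := by positivity
  have hrung : (numCompletions (circularLadder k) (2 * k + 2) (insert (r + 1, i) {(r, i)}) : ℚ) =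
      ((2 * k + 2).factorial : ℚ) * (1 / (k.factorial : ℚ)) := by
    rw [(isArc_rung r i).numCompletions (card_compl_pair (by simp)), setWeight_rung]
  rw [numCompletions, Nat.cast_sum]
  rcases Nat.eq_zero_or_pos k with rfl | hk
  · have hb : outerBoundary (circularLadder 0) {(r, i)} = {(r + 1, i), (r, i + 1)} := by
      ext w
      have : i - 1 = i + 1 := fin_two_sub_one i
      simp only [mem_outerBoundary_singleton, Finset.mem_insert, Finset.mem_singleton, this]
      tauto
    have hpair : (numCompletions (circularLadder 0) (2 * 0 + 2) (insert (r, i + 1) {(r, i)})) =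
        (2 * 0 + 2).factorial := by
      refine numCompletions_eq_factorial _ _ _ (card_compl_pair (by simp)) ?_
      rintro ⟨r', j⟩ hw
      refine ⟨(r, j), ?_, (circularLadder_adj _ _).2 (Or.inl ⟨?_, rfl⟩)⟩
      · have := fin_two_eq_or i j
        simpa using this
      · rintro rfl
        have := fin_two_eq_or i j
        simp_all
    rw [hb, Finset.sum_pair (by simp), hrung, hpair]
    norm_num
  · have hii : i - 1 ≠ i + 1 := by
      intro h
      apply (isArc_pair hk r i).ne
      rw [← h, sub_add_cancel]
    have hb : outerBoundary (circularLadder k) {(r, i)} =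
        {(r + 1, i), (r, i + 1), (r, i - 1)} := by
      ext w
      simp [mem_outerBoundary_singleton]
    -- The step backwards gives the same visited set as a forward step from `i - 1`.
    have hpair' : insert (r, i - 1) {(r, i)} =
        (insert (r, i - 1 + 1) {(r, i - 1)} : Finset (Fin 2 × Fin (k + 2))) := by
      rw [sub_add_cancel, Finset.pair_comm]
    rw [hb, Finset.sum_insert (by simp), Finset.sum_pair (by simpa using hii.symm), hrung, hpair',
      numCompletions_pair hk, numCompletions_pair hk]
    field_simp
    ring

end CircularLadderStart

theorem mainTheorem4 (n : ℕ) (hn : 2 ≤ n) :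
    (numRandomWalkLabelings (SimpleGraph.boxProd (SimpleGraph.cycleGraph 2)
        (SimpleGraph.cycleGraph n)) : ℚ) =
      (n : ℚ) * ((n : ℚ) + 2) * (Nat.factorial (2 * n - 2) : ℚ) / (Nat.factorial (n - 2) : ℚ) := by
  obtain ⟨k, rfl⟩ := Nat.exists_eq_add_of_le' hn
  have hcard : Fintype.card (Fin 2 × Fin (k + 2)) = 2 * k + 4 := by
    simp; ring
  rw [numRandomWalkLabelings_eq_sum, hcard, show 2 * k + 4 - 1 = 2 * k + 3 from rfl, Nat.cast_sum,
    Finset.sum_congr rfl fun v _ => numCompletions_singleton v, Finset.sum_const, Finset.card_univ,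
    hcard, show 2 * (k + 2) - 2 = 2 * k + 2 by omega, Nat.add_sub_cancel, nsmul_eq_mul]
  push_cast
  ring
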